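/- Let $\Gamma$ be a convex polyhedron, i.e. the convex hull of finitely many points in $\mathbb{R}^3$ with nonempty interior, with $v$ vertices, $e$ edges and $f$ (two-dimensional) faces, and fix an arbitrary labeling of its edges by $1,\dots,e$. Let $\mathcal{C}(\Gamma)\subseteq \mathbb{F}_2^e$ be the set of all vectors $c$ such that, for every vertex of $\Gamma$, the entries of $c$ at the edges meeting at that vertex sum to zero over $\mathbb{F}_2$. Then $\mathcal{C}(\Gamma)$ is an $[e, f-1]$ binary linear code, i.e. a linear subspace of $\mathbb{F}_2^e$ of dimension $f-1$. Moreover, $\mathcal{C}(\Gamma)$ is the linear span of the vectors corresponding to the faces of $\Gamma$, where the vector corresponding to a face has entry $1$ at the edges contained in that face and entry $0$ at all other edges. -/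

import Mathlib

/-- A convex polyhedron: the convex hull of finitely many points of Euclidean 3-space that is
genuinely three-dimensional, i.e. has nonempty interior. -/
structure ConvexPolyhedron where
  carrier : Set (EuclideanSpace ℝ (Fin 3))
  exists_finite_hull : ∃ S : Set (EuclideanSpace ℝ (Fin 3)), S.Finite ∧ carrier = convexHull ℝ S
  interior_nonempty : (interior carrier).Nonempty

namespace ConvexPolyhedron

/-- `F` is a face of `Γ` of dimension `d`: a nonempty set cut out of `Γ` by a supporting plane
(the set of maximizers of a linear functional on `Γ`) whose affine hull has dimension `d`. -/
def IsFaceOfDim (Γ : ConvexPolyhedron) (d : ℕ) (F : Set (EuclideanSpace ℝ (Fin 3))) : Prop :=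
  F.Nonempty ∧ IsExposed ℝ Γ.carrier F ∧ Module.finrank ℝ (vectorSpan ℝ F) = d

/-- The vertices of `Γ`, as zero-dimensional faces (singletons). -/
def Vertex (Γ : ConvexPolyhedron) : Type := {F // Γ.IsFaceOfDim 0 F}

/-- The edges of `Γ`. -/
def Edge (Γ : ConvexPolyhedron) : Type := {F // Γ.IsFaceOfDim 1 F}

/-- The (two-dimensional) faces of `Γ`. -/
def Face (Γ : ConvexPolyhedron) : Type := {F // Γ.IsFaceOfDim 2 F}

theorem finite_faceOfDim (Γ : ConvexPolyhedron) (d : ℕ) : Finite {F // Γ.IsFaceOfDim d F} := by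
  obtain ⟨S, hS, hP⟩ := Γ.exists_finite_hull
  have hc : IsCompact Γ.carrier := hP ▸ hS.isCompact_convexHull (𝕜 := ℝ)
  have hconv : Convex ℝ Γ.carrier := hP ▸ convex_convexHull ℝ S
  have hfin : Set.Finite {F | Γ.IsFaceOfDim d F} := by
    refine Set.Finite.of_finite_image (f := fun F => F.extremePoints ℝ)
      (hS.finite_subsets.subset ?_) ?_
    · rintro _ ⟨F, hF, rfl⟩
      have h1 := hF.2.1.isExtreme.extremePoints_subset_extremePoints
      refine h1.trans ?_
      rw [hP]
      exact extremePoints_convexHull_subset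
    · intro F hF G hG hFG
      have hFG' : F.extremePoints ℝ = G.extremePoints ℝ := hFG
      rw [← closure_convexHull_extremePoints (hF.2.1.isCompact hc) (hF.2.1.convex hconv),
        ← closure_convexHull_extremePoints (hG.2.1.isCompact hc) (hG.2.1.convex hconv), hFG']
  exact hfin

instance (Γ : ConvexPolyhedron) : Finite Γ.Vertex := Γ.finite_faceOfDim 0
instance (Γ : ConvexPolyhedron) : Finite Γ.Edge := Γ.finite_faceOfDim 1
instance (Γ : ConvexPolyhedron) : Finite Γ.Face := Γ.finite_faceOfDim 2

open Classical in
/-- The code generated by `Γ`, for a labeling of its edges by `Fin e`: the binary words whose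
entries at the edges meeting at any given vertex sum to zero. -/
def code (Γ : ConvexPolyhedron) {e : ℕ} (label : Fin e ≃ Γ.Edge) : Set (Fin e → ZMod 2) :=
  {c | ∀ x : Γ.Vertex, ∑ i with x.1 ⊆ (label i).1, c i = 0}

open Classical in
/-- The binary word corresponding to a face: its ones are exactly at the edges of that face. -/
noncomputable def faceVector (Γ : ConvexPolyhedron) {e : ℕ} (label : Fin e ≃ Γ.Edge)
    (F : Γ.Face) : Fin e → ZMod 2 :=
  fun i => if (label i).1 ⊆ F.1 then 1 else 0

end ConvexPolyhedron

/-- `C` is an `[n, k]` binary linear code: a `k`-dimensional linear subspace of `GF(2)ⁿ`. -/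
def IsBinaryLinearCode (n k : ℕ) (C : Set (Fin n → ZMod 2)) : Prop :=
  ∃ W : Submodule (ZMod 2) (Fin n → ZMod 2), (W : Set (Fin n → ZMod 2)) = C ∧
    Module.finrank (ZMod 2) W = k

/-! Replacing each point `s` by `(s, 1)` turns `d`-dimensional faces of the polyhedron into rank `d
+ 1` faces of a cone, recorded by the generators they contain. There the diamond property
`IsConeFace.exists_two_covers` holds: a face has two edges at each of its vertices, and each edge
lies in two faces. The first puts the face words in the code.

Spanning is a sweep by a height function separating the generators. Let `s` be the highest vertex
met by the support of a codeword. If two edges descending from `s` lie in one face, `s` is the top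
of that face, whose word is those two edges plus edges below `s`. `IsConeFace.link_connected` chains
all descending edges through such faces, so they agree modulo face words and lower edges. Parity at
`s` then cancels them, leaving a lower codeword.

For the dimension, a linear relation among face words takes equal values on faces sharing an edge.
Faces are connected around a vertex by `IsConeFace.link_connected`, and from vertex to vertex by
climbing edges, so the relation is constant; the constant 1 is one. Euler's formula is not needed.
-/

open Module Submodule

/-! ### Faces of a finitely generated cone and their covers -/

section ConeFaces

variable {ι W : Type*} [AddCommGroup W] [Module ℝ W]

/-- A face of the cone spanned by the vectors `v i`, recorded as the set of indices of the
generators lying on it: the zero set of a linear functional nonnegative on all generators. -/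
def IsConeFace (v : ι → W) (A : Set ι) : Prop :=
  ∃ w : W →ₗ[ℝ] ℝ, (∀ i, 0 ≤ w (v i)) ∧ ∀ i, i ∈ A ↔ w (v i) = 0

/-- The dimension of the linear span of the generators with index in `A`. -/
noncomputable def coneRank (v : ι → W) (A : Set ι) : ℕ :=
  finrank ℝ (span ℝ (v '' A))

/-- The face `C` of the cone spanned by `v` has dimension one more than the subset `A`. -/
structure IsConeCover (v : ι → W) (A C : Set ι) : Prop where
  isFace : IsConeFace v C
  subset : A ⊆ C
  rank_eq : coneRank v C = coneRank v A + 1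

variable {v : ι → W} {A B C D : Set ι}

theorem isConeFace_univ : IsConeFace v Set.univ := ⟨0, by simp, by simp⟩

theorem LinearMap.eq_zero_of_mem_span_image {w : W →ₗ[ℝ] ℝ} (h : ∀ i ∈ A, w (v i) = 0) {x : W}
    (hx : x ∈ span ℝ (v '' A)) : w x = 0 := by
  have : span ℝ (v '' A) ≤ LinearMap.ker w := by
    rw [span_le]
    rintro _ ⟨i, hi, rfl⟩
    exact h i hi
  exact this hx

theorem exists_linearMap_ne_zero_of_notMem_span {x : W} (hx : x ∉ span ℝ (v '' A)) :
    ∃ w : W →ₗ[ℝ] ℝ, (∀ i ∈ A, w (v i) = 0) ∧ w x ≠ 0 := by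
  obtain ⟨w, hw, hle⟩ := Submodule.exists_le_ker_of_notMem hx
  exact ⟨w, fun i hi => hle (subset_span ⟨i, hi, rfl⟩), hw⟩

namespace IsConeFace

theorem mem_of_mem_span (hA : IsConeFace v A) {i : ι} (hi : v i ∈ span ℝ (v '' A)) : i ∈ A := by
  obtain ⟨w, -, hw⟩ := hA
  exact (hw i).2 (LinearMap.eq_zero_of_mem_span_image (fun j hj => (hw j).1 hj) hi)

/-- A face of a face of a finitely generated cone is a face of the cone. -/
theorem of_subface [Finite ι] (hB : IsConeFace v B) (hAB : A ⊆ B) {w : W →ₗ[ℝ] ℝ}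
    (hw : ∀ i ∈ B, 0 ≤ w (v i)) (hw0 : ∀ i ∈ B, (i ∈ A ↔ w (v i) = 0)) : IsConeFace v A := by
  obtain ⟨b, hb, hb0⟩ := hB
  -- Off `B` the functional `b` is positive, so a large multiple of it outweighs `w`; the `+ 1`
  -- makes this strict. Indices in `B` only contribute a harmless quotient by zero.
  obtain ⟨N, hN⟩ := (Set.finite_range fun i => (|w (v i)| + 1) / b (v i)).bddAbove
  have key : ∀ i, i ∉ B → 0 < w (v i) + N * b (v i) := by
    intro i hi
    have hpos : 0 < b (v i) := lt_of_le_of_ne (hb i) fun h => hi ((hb0 i).2 h.symm)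
    have h1 : (|w (v i)| + 1) / b (v i) ≤ N := hN ⟨i, rfl⟩
    rw [div_le_iff₀ hpos] at h1
    linarith [neg_abs_le (w (v i))]
  refine ⟨w + N • b, fun i => ?_, fun i => ?_⟩
  · by_cases hi : i ∈ B
    · simpa [(hb0 i).1 hi] using hw i hi
    · simpa using (key i hi).le
  · by_cases hi : i ∈ B
    · simpa [(hb0 i).1 hi] using hw0 i hi
    · have := (key i hi).ne'
      simpa [this] using fun h => hi (hAB h)

theorem exists_exposing (hA : IsConeFace v A) : ∃ u : W →ₗ[ℝ] ℝ,
    (∀ i ∈ A, u (v i) = 0) ∧ ∀ i, i ∉ A → 0 < u (v i) := by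
  obtain ⟨w, hw, hw0⟩ := hA
  exact ⟨w, fun i hi => (hw0 i).1 hi,
    fun i hi => lt_of_le_of_ne (hw i) fun h => hi ((hw0 i).2 h.symm)⟩

end IsConeFace

variable [FiniteDimensional ℝ W]

theorem IsConeFace.coneRank_lt (hA : IsConeFace v A) (h : A ⊂ B) :
    coneRank v A < coneRank v B := by
  obtain ⟨i, hiB, hiA⟩ := Set.exists_of_ssubset h
  refine Submodule.finrank_lt_finrank_of_lt
    (lt_of_le_of_ne (span_mono (Set.image_mono h.subset)) fun heq => hiA ?_)
  exact hA.mem_of_mem_span (heq ▸ subset_span ⟨i, hiB, rfl⟩)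

theorem IsConeFace.eq_of_subset_of_coneRank_le (hA : IsConeFace v A) (h : A ⊆ B)
    (hr : coneRank v B ≤ coneRank v A) : A = B := by
  by_contra hne
  exact absurd (hA.coneRank_lt (h.ssubset_of_ne hne)) (by omega)

theorem coneRank_insert_le (i : ι) : coneRank v (insert i A) ≤ coneRank v A + 1 := by
  unfold coneRank
  rw [Set.image_insert_eq, span_insert, sup_comm]
  refine (Submodule.finrank_add_le_finrank_add_finrank _ _).trans ?_
  gcongr
  simpa using finrank_span_le_card (R := ℝ) ({v i} : Set W)

theorem exists_notMem_span_of_coneRank_lt (h : coneRank v A < coneRank v B) :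
    ∃ i ∈ B, v i ∉ span ℝ (v '' A) := by
  by_contra! hcon
  have : span ℝ (v '' B) ≤ span ℝ (v '' A) := by
    rw [span_le]
    rintro _ ⟨i, hi, rfl⟩
    exact hcon i hi
  exact absurd (Submodule.finrank_mono this) (not_le.2 h)

namespace IsConeCover

omit [FiniteDimensional ℝ W] in
theorem ssubset (hC : IsConeCover v A C) : A ⊂ C :=
  hC.subset.ssubset_of_ne fun h => by
    have := hC.rank_eq
    rw [← h] at this
    omega

/-- `C` has one dimension more than `A`, and any generator outside `A` supplies it. Hence distinct
covers of `A` share no generator outside `A`. -/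
theorem span_eq (hA : IsConeFace v A) (hC : IsConeCover v A C) {i : ι} (hiC : i ∈ C)
    (hiA : i ∉ A) : span ℝ (v '' insert i A) = span ℝ (v '' C) := by
  refine Submodule.eq_of_le_of_finrank_le
    (span_mono (Set.image_mono (Set.insert_subset hiC hC.subset))) ?_
  have h1 := hA.coneRank_lt (Set.ssubset_insert hiA)
  have h2 := hC.rank_eq
  unfold coneRank at *
  omega

theorem subset_of_mem (hA : IsConeFace v A) (hC : IsConeCover v A C) (hD : IsConeFace v D)
    (hAD : A ⊆ D) {i : ι} (hiC : i ∈ C) (hiA : i ∉ A) (hiD : i ∈ D) : C ⊆ D := by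
  intro j hj
  refine hD.mem_of_mem_span ?_
  have : v j ∈ span ℝ (v '' insert i A) := span_eq hA hC hiC hiA ▸ subset_span ⟨j, hj, rfl⟩
  exact span_mono (Set.image_mono (Set.insert_subset hiD hAD)) this

theorem eq_of_mem (hA : IsConeFace v A) (hC : IsConeCover v A C) (hD : IsConeCover v A D)
    {i : ι} (hiC : i ∈ C) (hiA : i ∉ A) (hiD : i ∈ D) : C = D :=
  (hC.subset_of_mem hA hD.isFace hD.subset hiC hiA hiD).antisymm
    (hD.subset_of_mem hA hC.isFace hC.subset hiD hiA hiC)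

theorem eq_zero_of_mem (hA : IsConeFace v A) (hC : IsConeCover v A C) {q : W →ₗ[ℝ] ℝ}
    (hq : ∀ i ∈ A, q (v i) = 0) {i j : ι} (hiC : i ∈ C) (hiA : i ∉ A) (hi : q (v i) = 0)
    (hj : j ∈ C) : q (v j) = 0 := by
  have hmem : v j ∈ span ℝ (v '' insert i A) := by
    rw [span_eq hA hC hiC hiA]
    exact subset_span ⟨j, hj, rfl⟩
  refine LinearMap.eq_zero_of_mem_span_image (A := insert i A) ?_ hmem
  rintro k (rfl | hk)
  exacts [hi, hq k hk]

end IsConeCover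

/-! ### Existence of covers, the diamond property, connectedness of links -/

variable [Finite ι]

omit [FiniteDimensional ℝ W] in
/-- The generators of `B` outside `A` at which the ratio `t / u` is maximal form, together with
`A`, a face. -/
theorem IsConeFace.exists_ratio_face (hB : IsConeFace v B) (hAB : A ⊂ B) {u t : W →ₗ[ℝ] ℝ}
    (hu : ∀ i ∈ A, u (v i) = 0) (hu' : ∀ i, i ∉ A → 0 < u (v i)) (ht : ∀ i ∈ A, t (v i) = 0) :
    ∃ (M : ℝ) (D : Set ι), IsConeFace v D ∧ A ⊂ D ∧ D ⊆ B ∧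
      (∀ i ∈ B, t (v i) ≤ M * u (v i)) ∧ ∀ i ∈ B, (i ∈ D ↔ t (v i) = M * u (v i)) := by
  obtain ⟨j, hj, hjmax⟩ := Set.exists_max_image (B \ A) (fun i => t (v i) / u (v i))
    (Set.toFinite _) (Set.nonempty_of_ssubset hAB)
  set M := t (v j) / u (v j) with hM
  have hle : ∀ i ∈ B, t (v i) ≤ M * u (v i) := by
    intro i hi
    by_cases hiA : i ∈ A
    · simp [hu i hiA, ht i hiA]
    · have := hjmax i ⟨hi, hiA⟩
      rwa [div_le_iff₀ (hu' i hiA)] at this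
  refine ⟨M, {i ∈ B | t (v i) = M * u (v i)}, ?_, ?_, fun i hi => hi.1, hle,
    fun i hi => by simp [hi]⟩
  · refine hB.of_subface (w := M • u - t) (fun i hi => hi.1) (fun i hi => ?_) fun i hi => ?_
    · simpa using hle i hi
    · simp [hi, sub_eq_zero, eq_comm (a := M * u (v i))]
  · have hsub : A ⊆ {i ∈ B | t (v i) = M * u (v i)} :=
      fun i hi => ⟨hAB.subset hi, by simp [hu i hi, ht i hi]⟩
    refine hsub.ssubset_of_mem_notMem (a := j) ⟨hj.1, ?_⟩ hj.2
    rw [hM, div_mul_cancel₀ _ (hu' j hj.2).ne']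

/-- Every proper subface of a face is covered by a subface of dimension one more. -/
theorem IsConeFace.exists_cover (hA : IsConeFace v A) (hB : IsConeFace v B) (hAB : A ⊂ B) :
    ∃ C, IsConeCover v A C ∧ C ⊆ B := by
  induction hn : coneRank v B using Nat.strong_induction_on generalizing B with
  | _ n ih =>
    have hlt := hA.coneRank_lt hAB
    by_cases hr : coneRank v B = coneRank v A + 1
    · exact ⟨B, ⟨hB, hAB.subset, hr⟩, subset_rfl⟩
    -- A rank gap of at least two leaves room for `t` vanishing on `A` and `y` but positive at `z`.
    -- The face maximizing `t / u` then misses `y`, so the induction applies to it.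
    obtain ⟨y, hyB, hyA⟩ := Set.exists_of_ssubset hAB
    obtain ⟨z, hzB, hz⟩ := exists_notMem_span_of_coneRank_lt (v := v) (A := insert y A) (B := B)
      (by have := coneRank_insert_le (v := v) (A := A) y; omega)
    obtain ⟨t₀, ht₀, hz₀⟩ := exists_linearMap_ne_zero_of_notMem_span hz
    obtain ⟨t, ht, htz⟩ : ∃ t : W →ₗ[ℝ] ℝ, (∀ i ∈ insert y A, t (v i) = 0) ∧ 0 < t (v z) := by
      rcases lt_or_gt_of_ne hz₀ with h | h
      · exact ⟨-t₀, fun i hi => by simp [ht₀ i hi], by simpa using h⟩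
      · exact ⟨t₀, ht₀, h⟩
    obtain ⟨u, hu, hu'⟩ := hA.exists_exposing
    obtain ⟨M, D, hD, hAD, hDB, hle, hmem⟩ := hB.exists_ratio_face hAB hu hu'
      (fun i hi => ht i (Set.mem_insert_of_mem _ hi))
    have hzA : z ∉ A := fun h => htz.ne' (ht z (Set.mem_insert_of_mem _ h))
    have hMpos : 0 < M := by
      by_contra! hM
      have := mul_nonpos_of_nonpos_of_nonneg hM (hu' z hzA).le
      linarith [hle z hzB]
    have hyD : y ∉ D := fun h => by
      have h1 := (hmem y hyB).1 h
      rw [ht y (Set.mem_insert _ _)] at h1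
      exact (mul_pos hMpos (hu' y hyA)).ne h1
    have hDB' : D ⊂ B := hDB.ssubset_of_mem_notMem hyB hyD
    obtain ⟨C, hC, hCD⟩ := ih _ (hn ▸ hD.coneRank_lt hDB') hD hAD rfl
    exact ⟨C, hC, hCD.trans hDB⟩

/-- If a functional vanishing on the face `A` is positive somewhere on a face `B` containing `A`,
then it is positive on some face of `B` covering `A`. -/
theorem IsConeFace.exists_cover_pos (hA : IsConeFace v A) (hB : IsConeFace v B) (hAB : A ⊆ B)
    {q : W →ₗ[ℝ] ℝ} (hq : ∀ i ∈ A, q (v i) = 0) {s : ι} (hsB : s ∈ B) (hs : 0 < q (v s)) :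
    ∃ C, IsConeCover v A C ∧ C ⊆ B ∧ ∀ i ∈ C, i ∉ A → 0 < q (v i) := by
  have hsA : s ∉ A := fun h => hs.ne' (hq s h)
  obtain ⟨u, hu, hu'⟩ := hA.exists_exposing
  obtain ⟨M, D, hD, hAD, hDB, hle, hmem⟩ :=
    hB.exists_ratio_face (hAB.ssubset_of_mem_notMem hsB hsA) hu hu' hq
  have hMpos : 0 < M := by
    by_contra! hM
    have := mul_nonpos_of_nonpos_of_nonneg hM (hu' s hsA).le
    linarith [hle s hsB]
  obtain ⟨C, hC, hCD⟩ := hA.exists_cover hD hAD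
  refine ⟨C, hC, hCD.trans hDB, fun i hi hiA => ?_⟩
  rw [(hmem i (hDB (hCD hi))).1 (hCD hi)]
  exact mul_pos hMpos (hu' i hiA)

/-- A functional exposing `C` is positive somewhere on `B`, hence on some cover of `A` in `B`; that
cover cannot be `C`. -/
theorem IsConeFace.exists_ne_cover (hA : IsConeFace v A) (hB : IsConeFace v B)
    (hr : coneRank v B = coneRank v A + 2) (hC : IsConeCover v A C) (hCB : C ⊆ B) :
    ∃ D, IsConeCover v A D ∧ D ⊆ B ∧ D ≠ C := by
  obtain ⟨u, hu, hu'⟩ := hC.isFace.exists_exposing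
  have hne : C ⊂ B := hCB.ssubset_of_ne fun h => by
    have := hC.rank_eq
    rw [h] at this
    omega
  obtain ⟨s, hsB, hsC⟩ := Set.exists_of_ssubset hne
  obtain ⟨D, hD, hDB, hpos⟩ := hA.exists_cover_pos hB (hC.subset.trans hCB)
    (fun i hi => hu i (hC.subset hi)) hsB (hu' s hsC)
  refine ⟨D, hD, hDB, ?_⟩
  rintro rfl
  obtain ⟨i, hi, hiA⟩ := Set.exists_of_ssubset hC.ssubset
  exact (hpos i hi hiA).ne' (hu i hi)

-- Generators `y k` of three distinct covers are dependent in the two-dimensional quotient by the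
-- span of `A`. Applying the functional exposing `C k` kills the `k`-th term and leaves positive
-- factors on the other two coefficients, so any two coefficients have opposite signs or both
-- vanish. Three reals can only do this by being zero.
omit [Finite ι] in
theorem IsConeFace.not_three_covers (hA : IsConeFace v A)
    (hr : coneRank v B = coneRank v A + 2) {C : Fin 3 → Set ι}
    (hC : ∀ k, IsConeCover v A (C k)) (hCB : ∀ k, C k ⊆ B) : ¬ Function.Injective C := by
  intro hinj
  choose y hyC hyA using fun k => Set.exists_of_ssubset (hC k).ssubset
  choose t ht ht' using fun k => (hC k).isFace.exists_exposing
  have hpos : ∀ k m, k ≠ m → 0 < t k (v (y m)) := fun k m hkm => ht' k _ fun h =>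
    hkm (hinj ((hC k).eq_of_mem hA (hC m) h (hyA m) (hyC m)))
  obtain ⟨a, ha, ha0⟩ : ∃ a : Fin 3 → ℝ, (∑ k, a k • v (y k)) ∈ span ℝ (v '' A) ∧ a ≠ 0 := by
    have hnot : ¬ LinearIndependent ℝ
        (fun k : Fin 3 => (span ℝ (v '' A)).mkQ (v (y k))) := by
      intro hli
      have hle : span ℝ (Set.range fun k : Fin 3 => (span ℝ (v '' A)).mkQ (v (y k))) ≤
          (span ℝ (v '' B)).map (span ℝ (v '' A)).mkQ := by
        rw [span_le]
        rintro _ ⟨k, rfl⟩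
        exact mem_map_of_mem (subset_span ⟨y k, hCB k (hyC k), rfl⟩)
      have h1 := Submodule.finrank_mono hle
      rw [finrank_span_eq_card hli, Fintype.card_fin] at h1
      have hAB : span ℝ (v '' A) ≤ span ℝ (v '' B) :=
        span_mono (Set.image_mono ((hC 0).subset.trans (hCB 0)))
      have h2 := LinearMap.finrank_range_add_finrank_ker
        ((span ℝ (v '' A)).mkQ.domRestrict (span ℝ (v '' B)))
      have h3 := (submoduleOfEquivOfLe hAB).finrank_eq
      rw [LinearMap.range_domRestrict, LinearMap.ker_domRestrict, ker_mkQ] at h2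
      unfold submoduleOf at h3
      unfold coneRank at hr
      omega
    rw [Fintype.not_linearIndependent_iff] at hnot
    obtain ⟨a, ha, k, hk⟩ := hnot
    refine ⟨a, ?_, fun h => hk (by simp [h])⟩
    rw [← (span ℝ (v '' A)).ker_mkQ, LinearMap.mem_ker, map_sum]
    simpa using ha
  have heq : ∀ k, ∑ m, a m * t k (v (y m)) = 0 := fun k => by
    have := LinearMap.eq_zero_of_mem_span_image (w := t k)
      (fun i hi => ht k i ((hC k).subset hi)) ha
    simpa using this
  have h0 := heq 0
  have h1 := heq 1
  have h2 := heq 2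
  simp only [Fin.sum_univ_three, ht 0 _ (hyC 0), ht 1 _ (hyC 1), ht 2 _ (hyC 2), mul_zero,
    zero_add, add_zero] at h0 h1 h2
  have opp : ∀ {x y p q : ℝ}, 0 < p → 0 < q → x * p + y * q = 0 →
      (x < 0 ∧ 0 < y) ∨ (x = 0 ∧ y = 0) ∨ (0 < x ∧ y < 0) := by
    intro x y p q hp hq h
    rcases lt_trichotomy x 0 with hx | hx | hx
    · left; refine ⟨hx, ?_⟩
      by_contra! hy
      nlinarith [mul_neg_of_neg_of_pos hx hp, mul_nonpos_of_nonpos_of_nonneg hy hq.le]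
    · right; left
      refine ⟨hx, ?_⟩
      subst hx
      simpa [hq.ne'] using h
    · right; right; refine ⟨hx, ?_⟩
      by_contra! hy
      nlinarith [mul_pos hx hp, mul_nonneg hy hq.le]
  have e0 := opp (hpos 0 1 (by decide)) (hpos 0 2 (by decide)) h0
  have e1 := opp (hpos 1 0 (by decide)) (hpos 1 2 (by decide)) h1
  have e2 := opp (hpos 2 0 (by decide)) (hpos 2 1 (by decide)) h2
  apply ha0
  have : a 0 = 0 ∧ a 1 = 0 ∧ a 2 = 0 := by
    rcases e0 with h | h | h <;> rcases e1 with h' | h' | h' <;> rcases e2 with h'' | h'' | h'' <;>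
      first
        | exact ⟨h'.1, h.1, h.2⟩
        | (exfalso; linarith [h.1, h.2, h'.1, h'.2, h''.1, h''.2])
  funext k
  fin_cases k
  exacts [this.1, this.2.1, this.2.2]

/-- Between two faces whose dimensions differ by two there are exactly two further faces. -/
theorem IsConeFace.exists_two_covers (hA : IsConeFace v A) (hB : IsConeFace v B) (hAB : A ⊆ B)
    (hr : coneRank v B = coneRank v A + 2) :
    ∃ C D, C ≠ D ∧ (IsConeCover v A C ∧ C ⊆ B) ∧ (IsConeCover v A D ∧ D ⊆ B) ∧
      ∀ X, IsConeCover v A X → X ⊆ B → X = C ∨ X = D := by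
  have hne : A ⊂ B := hAB.ssubset_of_ne fun h => by rw [h] at hr; omega
  obtain ⟨C, hC, hCB⟩ := hA.exists_cover hB hne
  obtain ⟨D, hD, hDB, hDC⟩ := hA.exists_ne_cover hB hr hC hCB
  refine ⟨C, D, hDC.symm, ⟨hC, hCB⟩, ⟨hD, hDB⟩, fun X hX hXB => ?_⟩
  by_contra! hcon
  refine hA.not_three_covers hr (C := ![C, D, X]) ?_ ?_ ?_
  · intro k; fin_cases k; exacts [hC, hD, hX]
  · intro k; fin_cases k; exacts [hCB, hDB, hXB]
  · intro k m h
    fin_cases k <;> fin_cases m <;> simp_all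

/-- Keeps the face maximizing `p / u` proper in `IsConeFace.link_connected`. If the first exposing
functional is proportional to `p`, it is tilted by a functional `t`; a large multiple of the
original preserves positivity. -/
theorem IsConeFace.exists_exposing_not_proportional (hA : IsConeFace v A) (hAB : A ⊂ B)
    (hr : coneRank v A + 2 ≤ coneRank v B) (p : W →ₗ[ℝ] ℝ) :
    ∃ u : W →ₗ[ℝ] ℝ, (∀ i ∈ A, u (v i) = 0) ∧ (∀ i, i ∉ A → 0 < u (v i)) ∧
      ∀ M : ℝ, M ≠ 0 → ¬ ∀ i ∈ B, p (v i) = M * u (v i) := by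
  obtain ⟨u, hu, hu'⟩ := hA.exists_exposing
  by_cases hp : ∃ M : ℝ, ∀ i ∈ B, p (v i) = M * u (v i)
  swap
  · exact ⟨u, hu, hu', fun M _ h => hp ⟨M, h⟩⟩
  obtain ⟨M, hM⟩ := hp
  obtain ⟨y, hyB, hyA⟩ := Set.exists_of_ssubset hAB
  obtain ⟨z, hzB, hz⟩ := exists_notMem_span_of_coneRank_lt (v := v) (A := insert y A) (B := B)
    (by have := coneRank_insert_le (v := v) (A := A) y; omega)
  obtain ⟨t, ht, htz⟩ := exists_linearMap_ne_zero_of_notMem_span hz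
  obtain ⟨N, hN⟩ := (Set.finite_range fun i => (|t (v i)| + 1) / u (v i)).bddAbove
  refine ⟨t + N • u, fun i hi => ?_, fun i hi => ?_, fun K hK h => ?_⟩
  · simp [hu i hi, ht i (Set.mem_insert_of_mem _ hi)]
  · have h1 : (|t (v i)| + 1) / u (v i) ≤ N := hN ⟨i, rfl⟩
    rw [div_le_iff₀ (hu' i hi)] at h1
    have := neg_abs_le (t (v i))
    simp only [LinearMap.add_apply, LinearMap.smul_apply, smul_eq_mul]
    linarith
  · have hy := (hM y hyB).symm.trans (h y hyB)
    have hz' := (hM z hzB).symm.trans (h z hzB)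
    simp only [LinearMap.add_apply, LinearMap.smul_apply, smul_eq_mul,
      ht y (Set.mem_insert _ _), zero_add] at hy hz'
    have hMK : M = K * N := mul_right_cancel₀ (hu' y hyA).ne' (by linarith)
    rw [hMK] at hz'
    have : K * t (v z) = 0 := by linarith
    exact (mul_ne_zero hK htz) this

/-- Connectedness of the part of a two-dimensional link on which a functional `p` is positive. -/
theorem IsConeFace.link_connected (hA : IsConeFace v A) (hB : IsConeFace v B)
    (hr : coneRank v B = coneRank v A + 3) {p : W →ₗ[ℝ] ℝ} (hp : ∀ i ∈ A, p (v i) = 0)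
    {α : Type*} (φ : Set ι → α)
    (hφ : ∀ F, IsConeFace v F → F ⊆ B → coneRank v F = coneRank v A + 2 → ∀ C D,
      IsConeCover v A C → C ⊆ F → (∀ i ∈ C, i ∉ A → 0 < p (v i)) →
      IsConeCover v A D → D ⊆ F → (∀ i ∈ D, i ∉ A → 0 < p (v i)) → φ C = φ D)
    (hC : IsConeCover v A C) (hCB : C ⊆ B) (hCp : ∀ i ∈ C, i ∉ A → 0 < p (v i))
    (hD : IsConeCover v A D) (hDB : D ⊆ B) (hDp : ∀ i ∈ D, i ∉ A → 0 < p (v i)) :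
    φ C = φ D := by
  have hAB : A ⊂ B := hC.ssubset.trans_subset hCB
  obtain ⟨u, hu, hu', hup⟩ := hA.exists_exposing_not_proportional hAB (by omega) p
  obtain ⟨M, T, hT, hAT, hTB, hle, hmem⟩ := hB.exists_ratio_face hAB hu hu' hp
  have hMpos : 0 < M := by
    obtain ⟨i, hi, hiA⟩ := Set.exists_of_ssubset hC.ssubset
    by_contra! hM
    have := mul_nonpos_of_nonpos_of_nonneg hM (hu' i hiA).le
    linarith [hle i (hCB hi), hCp i hi hiA]
  have hTB' : T ⊂ B := hTB.ssubset_of_ne fun h =>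
    hup M hMpos.ne' fun i hi => (hmem i hi).1 (h ▸ hi)
  have hrT := hT.coneRank_lt hTB'
  have hrA := hA.coneRank_lt hAT
  obtain ⟨X, hX, hXT⟩ := hA.exists_cover hT hAT
  have hXp : ∀ i ∈ X, i ∉ A → 0 < p (v i) := fun i hi hiA => by
    rw [(hmem i (hTB (hXT hi))).1 (hXT hi)]
    exact mul_pos hMpos (hu' i hiA)
  suffices key : ∀ C, IsConeCover v A C → C ⊆ B → (∀ i ∈ C, i ∉ A → 0 < p (v i)) →
      φ C = φ X from (key C hC hCB hCp).trans (key D hD hDB hDp).symm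
  by_contra hbad
  push Not at hbad
  obtain ⟨C₀, hC₀, hC₀B, hC₀p, hC₀X⟩ := hbad
  obtain ⟨i₀, hi₀, hi₀A⟩ := Set.exists_of_ssubset hC₀.ssubset
  -- As in the simplex method: among the covers with the wrong label, take one of greatest slope `p
  -- / u`. Unless that slope is already `M`, a face through it leads to a steeper cover with the
  -- same label.
  obtain ⟨i, ⟨hiA, E, hE, hEB, hEp, hEX, hiE⟩, himax⟩ := Set.exists_max_image
    {i | i ∉ A ∧ ∃ E, IsConeCover v A E ∧ E ⊆ B ∧ (∀ i ∈ E, i ∉ A → 0 < p (v i)) ∧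
      φ E ≠ φ X ∧ i ∈ E} (fun i => p (v i) / u (v i)) (Set.toFinite _)
    ⟨i₀, hi₀A, C₀, hC₀, hC₀B, hC₀p, hC₀X, hi₀⟩
  set r := p (v i) / u (v i) with hrdef
  have hri : p (v i) = r * u (v i) := by rw [hrdef, div_mul_cancel₀ _ (hu' i hiA).ne']
  have hrpos : 0 < r := div_pos (hEp i hiE hiA) (hu' i hiA)
  have hqE : ∀ j ∈ E, (p - r • u) (v j) = 0 := fun j hj =>
    hE.eq_zero_of_mem hA (q := p - r • u) (fun k hk => by simp [hp k hk, hu k hk]) hiE hiA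
      (by simp [hri]) hj
  by_cases hex : ∃ s ∈ B, 0 < (p - r • u) (v s)
  · obtain ⟨s, hsB, hs⟩ := hex
    obtain ⟨F, hF, hFB, hFpos⟩ := hE.isFace.exists_cover_pos hB hEB hqE hsB hs
    have hrF : coneRank v F = coneRank v A + 2 := by rw [hF.rank_eq, hE.rank_eq]
    obtain ⟨E', hE', hE'F, hne⟩ := hA.exists_ne_cover hF.isFace hrF hE hF.subset
    have hlt : ∀ j ∈ E', j ∉ A → r * u (v j) < p (v j) := fun j hj hjA => by
      have := hFpos j (hE'F hj) fun hjE => hne (hE'.eq_of_mem hA hE hj hjA hjE)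
      simpa using this
    have hE'p : ∀ j ∈ E', j ∉ A → 0 < p (v j) := fun j hj hjA =>
      (mul_pos hrpos (hu' j hjA)).trans (hlt j hj hjA)
    obtain ⟨j, hj, hjA⟩ := Set.exists_of_ssubset hE'.ssubset
    have hEE' := hφ F hF.isFace hFB hrF E E' hE hF.subset hEp hE' hE'F hE'p
    have := himax j ⟨hjA, E', hE', hE'F.trans hFB, hE'p, hEE' ▸ hEX, hj⟩
    rw [div_le_iff₀ (hu' j hjA)] at this
    exact absurd (hlt j hj hjA) (not_lt.2 this)
  · push Not at hex
    have hrM : r = M := by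
      obtain ⟨j, hj, hjA⟩ := Set.exists_of_ssubset hAT
      have h1 := hex j (hTB hj)
      have h2 := (hmem j (hTB hj)).1 hj
      have h3 := hle i (hEB hiE)
      rw [hri] at h3
      simp only [LinearMap.sub_apply, LinearMap.smul_apply, smul_eq_mul, h2] at h1
      refine le_antisymm (le_of_mul_le_mul_right h3 (hu' i hiA)) ?_
      exact le_of_mul_le_mul_right (by linarith) (hu' j hjA)
    have hET : E ⊆ T := fun j hj => (hmem j (hEB hj)).2 (by
      have := hqE j hj
      rw [← hrM]
      simpa [sub_eq_zero] using this)
    apply hEX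
    -- `T` is proper in `B`, so its rank exceeds that of `A` by one or two; in the former case `E =
    -- T = X`.
    by_cases hrT2 : coneRank v T = coneRank v A + 2
    · exact hφ T hT hTB hrT2 E X hE hET hEp hX hXT hXp
    · have h1 := hE.isFace.eq_of_subset_of_coneRank_le hET (by rw [hE.rank_eq]; omega)
      have h2 := hX.isFace.eq_of_subset_of_coneRank_le hXT (by rw [hX.rank_eq]; omega)
      rw [h1, h2]

end ConeFaces

/-! ### The binary code of a four-dimensional cone -/

section ConeCode

variable {ι W : Type*} [AddCommGroup W] [Module ℝ W]

/-- The faces of dimension `k` of the cone spanned by the vectors `v i`. -/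
abbrev ConeFaceOfRank (v : ι → W) (k : ℕ) : Type _ := {A : Set ι // IsConeFace v A ∧ coneRank v A = k}

/-- Finitely many nonzero differences must be avoided by one functional. It serves as a height
without ties. -/
theorem exists_linearMap_comp_injective [Finite ι] {v : ι → W} (hv : Function.Injective v) :
    ∃ l : W →ₗ[ℝ] ℝ, Function.Injective fun i => l (v i) := by
  obtain ⟨l, hl⟩ := Module.exists_dual_forall_apply_ne_zero (K := ℝ)
    (fun p : {p : ι × ι // p.1 ≠ p.2} => v p.1.1 - v p.1.2)
    (fun p => sub_ne_zero.2 (hv.ne p.2))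
  refine ⟨l, fun i j hij => ?_⟩
  by_contra hne
  apply hl ⟨(i, j), hne⟩
  simpa [sub_eq_zero] using hij

variable {v : ι → W} {h : W →ₗ[ℝ] ℝ}

theorem isConeFace_empty (hh : ∀ i, h (v i) = 1) : IsConeFace v ∅ :=
  ⟨h, by simp [hh], by simp [hh]⟩

theorem coneRank_empty : coneRank v ∅ = 0 := by
  rw [coneRank, Set.image_empty, span_empty, finrank_bot]

theorem coneRank_singleton (hh : ∀ i, h (v i) = 1) (i : ι) : coneRank v {i} = 1 := by
  unfold coneRank
  rw [Set.image_singleton]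
  exact finrank_span_singleton fun h0 => by simpa [h0] using hh i

theorem nonempty_of_coneRank_pos {A : Set ι} (hA : 0 < coneRank v A) : A.Nonempty := by
  rw [Set.nonempty_iff_ne_empty]
  rintro rfl
  simp [coneRank_empty] at hA

theorem IsConeFace.exists_vertex_max [Finite ι] (hh : ∀ i, h (v i) = 1) {l : W →ₗ[ℝ] ℝ}
    (hl : Function.Injective fun i => l (v i)) {B : Set ι} (hB : IsConeFace v B)
    (hne : B.Nonempty) : ∃ j ∈ B, IsConeFace v {j} ∧ ∀ i ∈ B, l (v i) ≤ l (v j) := by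
  obtain ⟨j, hj, hmax⟩ := Set.exists_max_image B (fun i => l (v i)) (Set.toFinite _) hne
  refine ⟨j, hj, ?_, hmax⟩
  refine hB.of_subface (w := l (v j) • h - l) (by simpa using hj) (fun i hi => ?_) fun i hi => ?_
  · simpa [hh] using hmax i hi
  · simp only [Set.mem_singleton_iff, LinearMap.sub_apply, LinearMap.smul_apply, hh, smul_eq_mul,
      mul_one, sub_eq_zero]
    exact ⟨fun e => by rw [e], fun e => (hl e).symm⟩

variable [FiniteDimensional ℝ W]

variable [Finite ι]

-- The diamond property in indexed form, used for the edges of a face at a vertex and for the faces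
-- at an edge (with `B` the whole cone).
open Classical in
theorem exists_filter_between_eq_pair {κ : Type*} [Fintype κ] {k : ℕ}
    (ε : κ ≃ ConeFaceOfRank v (k + 1)) {A B : Set ι} (hA : IsConeFace v A) (hB : IsConeFace v B)
    (hAB : A ⊆ B) (hAk : coneRank v A = k) (hBk : coneRank v B = k + 2) :
    ∃ i j, i ≠ j ∧ ({m | A ⊆ (ε m).1 ∧ (ε m).1 ⊆ B} : Finset κ) = {i, j} := by
  obtain ⟨C, D, hne, ⟨hC, hCB⟩, ⟨hD, hDB⟩, huniq⟩ := hA.exists_two_covers hB hAB (by omega)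
  refine ⟨ε.symm ⟨C, hC.isFace, by rw [hC.rank_eq, hAk]⟩,
    ε.symm ⟨D, hD.isFace, by rw [hD.rank_eq, hAk]⟩, fun e => hne ?_, ?_⟩
  · exact congrArg Subtype.val (ε.symm.injective e)
  · ext m
    simp only [Finset.mem_filter, Finset.mem_univ, true_and, Finset.mem_insert,
      Finset.mem_singleton, Equiv.eq_symm_apply]
    constructor
    · rintro ⟨h1, h2⟩
      rcases huniq _ ⟨(ε m).2.1, h1, by rw [(ε m).2.2, hAk]⟩ h2 with e | e
      · exact Or.inl (Subtype.ext e)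
      · exact Or.inr (Subtype.ext e)
    · rintro (e | e) <;> rw [e]
      exacts [⟨hC.subset, hCB⟩, ⟨hD.subset, hDB⟩]

variable {κ Z : Type*} [Fintype κ] (ε : κ ≃ ConeFaceOfRank v 2) (ζ : Z ≃ ConeFaceOfRank v 3)

open Classical in
/-- The word of a three-dimensional face of the cone: the indicator of its two-dimensional faces. -/
noncomputable def coneFaceWord (F : Z) : κ → ZMod 2 :=
  fun i => if (ε i).1 ⊆ (ζ F).1 then 1 else 0

open Classical in
/-- The words whose entries at the two-dimensional faces containing any given ray sum to zero. -/
def coneCode : Submodule (ZMod 2) (κ → ZMod 2) where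
  carrier := {c | ∀ x : ConeFaceOfRank v 1, ∑ i with x.1 ⊆ (ε i).1, c i = 0}
  add_mem' ha hb x := by simp [Finset.sum_add_distrib, ha x, hb x]
  zero_mem' x := by simp
  smul_mem' a c hc x := by simp [← Finset.mul_sum, hc x]

theorem coneFaceWord_mem_coneCode (F : Z) : coneFaceWord ε ζ F ∈ coneCode ε := by
  classical
  intro x
  simp only [coneFaceWord]
  rw [← Finset.sum_filter, Finset.filter_filter]
  by_cases hx : x.1 ⊆ (ζ F).1
  · obtain ⟨i, j, hij, hpair⟩ := exists_filter_between_eq_pair ε x.2.1 (ζ F).2.1 hx x.2.2 (ζ F).2.2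
    rw [hpair, Finset.sum_pair hij]
    decide
  · refine Finset.sum_eq_zero fun i hi => absurd ?_ hx
    simp only [Finset.mem_filter] at hi
    exact hi.2.1.trans hi.2.2

omit [Fintype κ] in
open Classical in
theorem mem_span_single_of_forall_eq_zero {R : Type*} [Semiring R] [Finite κ] {L : Set κ}
    {w : κ → R} (hw : ∀ k, k ∉ L → w k = 0) :
    w ∈ span R ((fun k => (Pi.single k 1 : κ → R)) '' L) := by
  cases nonempty_fintype κ
  rw [pi_eq_sum_univ' w]
  refine sum_mem fun k _ => ?_
  by_cases hk : k ∈ L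
  · exact smul_mem _ _ (subset_span ⟨k, hk, rfl⟩)
  · simp [hw k hk]

omit [Fintype κ] in
open Classical in
theorem eq_zero_of_mem_span_single {R : Type*} [CommSemiring R] {L : Set κ}
    {w : κ → R} (hw : w ∈ span R ((fun k => (Pi.single k 1 : κ → R)) '' L)) {k : κ} (hk : k ∉ L) :
    w k = 0 := by
  have : span R ((fun k => (Pi.single k 1 : κ → R)) '' L) ≤
      LinearMap.ker (LinearMap.proj k : (κ → R) →ₗ[R] R) := by
    rw [span_le]
    rintro _ ⟨m, hm, rfl⟩
    have : k ≠ m := fun e => hk (e ▸ hm)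
    simp [this]
  exact this hw

theorem coneCode_le_span_coneFaceWord (hh : ∀ i, h (v i) = 1) (hv : Function.Injective v)
    (hr : coneRank v Set.univ = 4) :
    coneCode ε ≤ span (ZMod 2) (Set.range (coneFaceWord ε ζ)) := by
  classical
  obtain ⟨l, hl⟩ := exists_linearMap_comp_injective hv
  set rk : ι → ℕ := fun i => {j | l (v j) < l (v i)}.ncard with hrk
  have hrk_lt : ∀ {i j}, l (v i) < l (v j) → rk i < rk j := fun {i j} hij =>
    Set.ncard_lt_ncard ⟨fun m (hm : _ < _) => hm.trans hij, fun hsub => lt_irrefl (l (v i)) (hsub hij)⟩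
      (Set.toFinite _)
  have hrk_le : ∀ {i j}, rk i ≤ rk j → l (v i) ≤ l (v j) := fun {i j} hij => by
    by_contra! hcon
    exact absurd (hrk_lt hcon) (not_lt.2 hij)
  have key : ∀ n, ∀ c ∈ coneCode ε, (∀ k, c k ≠ 0 → ∀ s ∈ (ε k).1, rk s < n) →
      c ∈ span (ZMod 2) (Set.range (coneFaceWord ε ζ)) := by
    intro n
    induction n with
    | zero =>
      intro c _ hsupp
      have : c = 0 := by
        funext k
        by_contra hk
        obtain ⟨s, hs⟩ := nonempty_of_coneRank_pos (v := v) (A := (ε k).1)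
          (by rw [(ε k).2.2]; omega)
        exact absurd (hsupp k hk s hs) (by omega)
      rw [this]
      exact zero_mem _
    | succ n ih =>
      intro c hc hsupp
      by_cases hex : ∃ k, c k ≠ 0 ∧ ∃ s ∈ (ε k).1, rk s = n
      swap
      · push Not at hex
        refine ih c hc fun k hk s hs => ?_
        have h1 := hsupp k hk s hs
        have h2 := hex k hk s hs
        omega
      obtain ⟨k₀, hk₀, s, hs, hsn⟩ := hex
      have htop : ∀ k, c k ≠ 0 → ∀ i ∈ (ε k).1, l (v i) ≤ l (v s) := fun k hk i hi => by
        refine hrk_le ?_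
        have := hsupp k hk i hi
        omega
      have hsface : IsConeFace v {s} := by
        obtain ⟨j, hj, hjf, hjmax⟩ := (ε k₀).2.1.exists_vertex_max hh hl ⟨s, hs⟩
        have : j = s := hl ((htop k₀ hk₀ j hj).antisymm (hjmax s hs))
        rwa [this] at hjf
      have hsrank := coneRank_singleton hh s
      set p : W →ₗ[ℝ] ℝ := l (v s) • h - l with hpdef
      have hpv : ∀ i, p (v i) = l (v s) - l (v i) := fun i => by simp [hpdef, hh]
      have hps : ∀ i ∈ ({s} : Set ι), p (v i) = 0 := by
        rintro i rfl
        simp [hpv]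
      set L : Set κ := {k | ∀ i ∈ (ε k).1, rk i < n} with hL
      set low := span (ZMod 2) ((fun k => (Pi.single k 1 : κ → ZMod 2)) '' L) with hlow
      set M := span (ZMod 2) (Set.range (coneFaceWord ε ζ)) ⊔ low with hM
      -- The class of an edge modulo face words and edges wholly below `s`; the default 0 is never
      -- used.
      let φ : Set ι → (κ → ZMod 2) ⧸ M := fun A =>
        if hA : IsConeFace v A ∧ coneRank v A = 2 then M.mkQ (Pi.single (ε.symm ⟨A, hA⟩) 1) else 0
      have hφε : ∀ k, φ (ε k).1 = M.mkQ (Pi.single k 1) := fun k => by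
        have : (⟨(ε k).1, (ε k).2⟩ : ConeFaceOfRank v 2) = ε k := rfl
        simp only [φ, dif_pos (ε k).2, this, Equiv.symm_apply_apply]
      have hcover : ∀ k, s ∈ (ε k).1 → IsConeCover v {s} (ε k).1 := fun k hk =>
        ⟨(ε k).2.1, by simpa using hk, by rw [(ε k).2.2, hsrank]⟩
      have hpos : ∀ k, c k ≠ 0 → ∀ i ∈ (ε k).1, i ∉ ({s} : Set ι) → 0 < p (v i) := by
        intro k hk i hi his
        rw [hpv, sub_pos]
        exact lt_of_le_of_ne (htop k hk i hi) (hl.ne his)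
      have hlink : ∀ F, IsConeFace v F → F ⊆ Set.univ → coneRank v F = coneRank v {s} + 2 →
          ∀ C D, IsConeCover v {s} C → C ⊆ F → (∀ i ∈ C, i ∉ ({s} : Set ι) → 0 < p (v i)) →
          IsConeCover v {s} D → D ⊆ F → (∀ i ∈ D, i ∉ ({s} : Set ι) → 0 < p (v i)) →
          φ C = φ D := by
        intro F hF _ hFr C D hC hCF hCp hD hDF hDp
        by_cases hCD : C = D
        · rw [hCD]
        have huniq : ∀ X, IsConeCover v {s} X → X ⊆ F → X = C ∨ X = D := by
          obtain ⟨Y₁, Y₂, -, -, -, hY⟩ := hsface.exists_two_covers hF (hC.subset.trans hCF) hFr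
          intro X hX hXF
          have h1 := hY X hX hXF
          have h2 := hY C hC hCF
          have h3 := hY D hD hDF
          grind
        -- If `F` rose above `s`, it would have an ascending edge at `s`, a third one besides `C`
        -- and `D`.
        have hFpos : ∀ i ∈ F, i ≠ s → 0 < p (v i) := by
          intro i hi his
          by_contra! hneg
          have hneg' : 0 < (-p) (v i) := by
            rw [LinearMap.neg_apply, neg_pos]
            refine lt_of_le_of_ne hneg ?_
            rw [hpv]
            exact sub_ne_zero.2 (hl.ne his.symm)
          obtain ⟨X, hX, hXF, hXp⟩ := hsface.exists_cover_pos hF (hC.subset.trans hCF)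
            (q := -p) (fun j hj => by simp [hps j hj]) hi hneg'
          obtain ⟨j, hj, hjs⟩ := Set.exists_of_ssubset hX.ssubset
          have h1 := hXp j hj hjs
          rw [LinearMap.neg_apply, neg_pos] at h1
          rcases huniq X hX hXF with rfl | rfl
          · exact absurd (hCp j hj hjs) h1.le.not_gt
          · exact absurd (hDp j hj hjs) h1.le.not_gt
        obtain ⟨kC, rfl⟩ : ∃ k, (ε k).1 = C :=
          ⟨ε.symm ⟨C, hC.isFace, by rw [hC.rank_eq, hsrank]⟩, by simp⟩
        obtain ⟨kD, rfl⟩ : ∃ k, (ε k).1 = D :=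
          ⟨ε.symm ⟨D, hD.isFace, by rw [hD.rank_eq, hsrank]⟩, by simp⟩
        obtain ⟨f, rfl⟩ : ∃ f, (ζ f).1 = F :=
          ⟨ζ.symm ⟨F, hF, by rw [hFr, hsrank]⟩, by simp⟩
        have hkne : kC ≠ kD := fun e => hCD (by rw [e])
        rw [hφε, hφε, ← sub_eq_zero, ← map_sub, mkQ_apply, Quotient.mk_eq_zero]
        -- Over `ZMod 2` the bracket is the face word with both edges at `s` deleted, hence
        -- supported below `s`.
        have hsplit : (Pi.single kC 1 - Pi.single kD 1 : κ → ZMod 2) =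
            coneFaceWord ε ζ f - (coneFaceWord ε ζ f - Pi.single kC 1 + Pi.single kD 1) := by
          abel
        rw [hsplit]
        refine sub_mem (mem_sup_left (subset_span ⟨f, rfl⟩)) (mem_sup_right ?_)
        refine mem_span_single_of_forall_eq_zero fun k hk => ?_
        by_cases hkC : k = kC
        · subst hkC
          simp [coneFaceWord, hCF, hkne]
        by_cases hkD : k = kD
        · subst hkD
          simp [coneFaceWord, hDF, hkC]
          decide
        have : ¬ (ε k).1 ⊆ (ζ f).1 := fun hkF => by
          apply hk
          intro i hi
          by_cases his : i = s
          · subst his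
            rcases huniq _ (hcover k hi) hkF with e | e
            · exact absurd (ε.injective (Subtype.ext e)) hkC
            · exact absurd (ε.injective (Subtype.ext e)) hkD
          · have := hFpos i (hkF hi) his
            rw [hpv, sub_pos] at this
            exact hsn ▸ hrk_lt this
        simp [coneFaceWord, this, hkC, hkD]
      have hconst : ∀ k, c k ≠ 0 → s ∈ (ε k).1 →
          M.mkQ (Pi.single k 1) = M.mkQ (Pi.single k₀ 1) := fun k hk hsk => by
        rw [← hφε, ← hφε]
        exact hsface.link_connected isConeFace_univ (by rw [hr, hsrank]) hps φ hlink
          (hcover k hsk) (Set.subset_univ _) (hpos k hk) (hcover k₀ hs) (Set.subset_univ _)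
          (hpos k₀ hk₀)
      have hcM : c ∈ M := by
        rw [← Quotient.mk_eq_zero, ← mkQ_apply, pi_eq_sum_univ' c, map_sum]
        -- Support edges through `s` all share the class of `k₀`, the others vanish modulo `M`;
        -- parity at `s` kills the total.
        have hterm : ∀ k, M.mkQ (c k • Pi.single k 1) =
            if {s} ⊆ (ε k).1 then c k • M.mkQ (Pi.single k₀ 1) else 0 := fun k => by
          by_cases hck : c k = 0
          · simp [hck]
          rw [map_smul]
          split_ifs with hsk
          · rw [hconst k hck (by simpa using hsk)]
          · have : (Pi.single k 1 : κ → ZMod 2) ∈ M := by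
              refine mem_sup_right (subset_span ⟨k, fun i hi => ?_, rfl⟩)
              have h1 := hpos k hck i hi (by rintro rfl; exact hsk (by simpa using hi))
              rw [hpv, sub_pos] at h1
              exact hsn ▸ hrk_lt h1
            rw [mkQ_apply, (Quotient.mk_eq_zero M).2 this, smul_zero]
        rw [Finset.sum_congr rfl fun k _ => hterm k, ← Finset.sum_filter, ← Finset.sum_smul]
        have := hc ⟨{s}, hsface, hsrank⟩
        simp only at this
        rw [this, zero_smul]
      obtain ⟨a, ha, b, hb, rfl⟩ := mem_sup.1 hcM
      have ha' : a ∈ coneCode ε := by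
        refine span_le.2 ?_ ha
        rintro _ ⟨F, rfl⟩
        exact coneFaceWord_mem_coneCode ε ζ F
      have hb' : b ∈ coneCode ε := by simpa using sub_mem hc ha'
      refine add_mem ha (ih b hb' fun k hk i hi => ?_)
      by_contra hcon
      exact hk (eq_zero_of_mem_span_single hb fun hkL => hcon (hkL i hi))
  obtain ⟨N, hN⟩ := (Set.finite_range rk).bddAbove
  exact fun c hc => key (N + 1) c hc fun k _ s _ => Nat.lt_succ_of_le (hN ⟨s, rfl⟩)

theorem span_coneFaceWord (hh : ∀ i, h (v i) = 1) (hv : Function.Injective v)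
    (hr : coneRank v Set.univ = 4) :
    span (ZMod 2) (Set.range (coneFaceWord ε ζ)) = coneCode ε := by
  refine le_antisymm (span_le.2 ?_) (coneCode_le_span_coneFaceWord ε ζ hh hv hr)
  rintro _ ⟨F, rfl⟩
  exact coneFaceWord_mem_coneCode ε ζ F

/-! ### Linear relations among the face words -/

variable [Fintype Z]

omit [Fintype κ] in
theorem exists_sum_smul_coneFaceWord_apply (hr : coneRank v Set.univ = 4) (k : κ) :
    ∃ F G, F ≠ G ∧ (∀ H, (ε k).1 ⊆ (ζ H).1 → H = F ∨ H = G) ∧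
      ∀ z : Z → ZMod 2, (∑ H, z H • coneFaceWord ε ζ H) k = z F + z G := by
  classical
  obtain ⟨F, G, hne, hpair⟩ := exists_filter_between_eq_pair ζ (ε k).2.1 isConeFace_univ
    (Set.subset_univ _) (ε k).2.2 hr
  simp only [Set.subset_univ, and_true] at hpair
  refine ⟨F, G, hne, fun H hH => ?_, fun z => ?_⟩
  · have : H ∈ ({m | (ε k).1 ⊆ (ζ m).1} : Finset Z) := by simpa using hH
    simpa [hpair] using this
  · simp only [Finset.sum_apply, Pi.smul_apply, coneFaceWord, smul_eq_mul, mul_ite, mul_one,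
      mul_zero]
    rw [← Finset.sum_filter, hpair, Finset.sum_pair hne]

omit [Fintype κ] in
theorem sum_coneFaceWord (hr : coneRank v Set.univ = 4) : ∑ F, coneFaceWord ε ζ F = 0 := by
  funext k
  obtain ⟨F, G, -, -, hz⟩ := exists_sum_smul_coneFaceWord_apply ε ζ hr k
  have := hz 1
  simp only [Pi.one_apply, one_smul] at this
  rw [this]
  exact CharTwo.add_self_eq_zero 1

omit [Fintype κ] in
theorem eq_of_sum_smul_coneFaceWord_eq_zero (hh : ∀ i, h (v i) = 1) (hv : Function.Injective v)
    (hr : coneRank v Set.univ = 4) {z : Z → ZMod 2}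
    (hz : ∑ F, z F • coneFaceWord ε ζ F = 0) (F G : Z) : z F = z G := by
  classical
  have hedge : ∀ C, IsConeFace v C → coneRank v C = 2 → ∀ F G, C ⊆ (ζ F).1 → C ⊆ (ζ G).1 →
      z F = z G := by
    intro C hC hCr F G hF hG
    obtain ⟨k, rfl⟩ : ∃ k, (ε k).1 = C := ⟨ε.symm ⟨C, hC, hCr⟩, by simp⟩
    obtain ⟨F₁, F₂, -, huniq, hsum⟩ := exists_sum_smul_coneFaceWord_apply ε ζ hr k
    have h0 := hsum z
    rw [hz, Pi.zero_apply] at h0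
    have h12 : z F₁ = z F₂ := by
      rw [← CharTwo.sub_eq_add] at h0
      exact sub_eq_zero.1 h0.symm
    rcases huniq F hF with rfl | rfl <;> rcases huniq G hG with rfl | rfl <;> simp [h12]
  have hvertex : ∀ i, IsConeFace v {i} → ∀ F G, i ∈ (ζ F).1 → i ∈ (ζ G).1 → z F = z G := by
    intro i hi F G hF hG
    have hir := coneRank_singleton hh i
    -- By `hedge`, the value of `z` on a face through the edge `C` does not depend on the face
    -- chosen.
    let φ : Set ι → ZMod 2 := fun C => if hC : ∃ F, C ⊆ (ζ F).1 then z hC.choose else 0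
    have hφ : ∀ C, IsConeCover v {i} C → ∀ F, C ⊆ (ζ F).1 → φ C = z F := fun C hC F hCF => by
      have hex : ∃ F, C ⊆ (ζ F).1 := ⟨F, hCF⟩
      simp only [φ, dif_pos hex]
      exact hedge C hC.isFace (by rw [hC.rank_eq, hir]) _ _ hex.choose_spec hCF
    have hss : ∀ F, i ∈ (ζ F).1 → {i} ⊂ (ζ F).1 := fun F hF =>
      (Set.singleton_subset_iff.2 hF).ssubset_of_ne fun e => by
        have := (ζ F).2.2
        rw [← e, hir] at this
        omega
    obtain ⟨C, hC, hCF⟩ := hi.exists_cover (ζ F).2.1 (hss F hF)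
    obtain ⟨D, hD, hDG⟩ := hi.exists_cover (ζ G).2.1 (hss G hG)
    rw [← hφ C hC F hCF, ← hφ D hD G hDG]
    obtain ⟨u, hu, hu'⟩ := hi.exists_exposing
    refine hi.link_connected isConeFace_univ (by rw [hr, hir]) hu φ ?_ hC (Set.subset_univ _)
      (fun j _ => hu' j) hD (Set.subset_univ _) fun j _ => hu' j
    intro H hH _ hHr X Y hX hXH _ hY hYH _
    obtain ⟨f, rfl⟩ : ∃ f, (ζ f).1 = H := ⟨ζ.symm ⟨H, hH, by rw [hHr, hir]⟩, by simp⟩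
    rw [hφ X hX f hXH, hφ Y hY f hYH]
  obtain ⟨l, hl⟩ := exists_linearMap_comp_injective hv
  obtain ⟨t, -, ht, htmax⟩ := isConeFace_univ.exists_vertex_max hh hl
    (nonempty_of_coneRank_pos (v := v) (by omega))
  -- From a highest bad vertex, an ascending edge leads to a higher vertex; a face through that edge
  -- carries the same value and makes it bad too.
  have hpath : ∀ i, IsConeFace v {i} → ∀ F, i ∈ (ζ F).1 → ∃ G, t ∈ (ζ G).1 ∧ z F = z G := by
    by_contra! hbad
    obtain ⟨i₀, hi₀, F₀, hF₀, hbad₀⟩ := hbad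
    obtain ⟨i, ⟨hi, F, hF, hbadF⟩, himax⟩ := Set.exists_max_image
      {i | IsConeFace v {i} ∧ ∃ F, i ∈ (ζ F).1 ∧ ∀ G, t ∈ (ζ G).1 → z F ≠ z G}
      (fun i => l (v i)) (Set.toFinite _) ⟨i₀, hi₀, F₀, hF₀, hbad₀⟩
    have hit : i ≠ t := by
      rintro rfl
      exact hbadF F hF rfl
    have hlt : l (v i) < l (v t) := lt_of_le_of_ne (htmax i (Set.mem_univ _)) (hl.ne hit)
    have hir := coneRank_singleton hh i
    obtain ⟨C, hC, -, hCpos⟩ := hi.exists_cover_pos isConeFace_univ (Set.subset_univ _)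
      (q := l - l (v i) • h) (fun j hj => by rw [Set.mem_singleton_iff.1 hj]; simp [hh])
      (Set.mem_univ t) (by simpa [hh] using hlt)
    obtain ⟨j, hj, hji⟩ := Set.exists_of_ssubset hC.ssubset
    obtain ⟨m, hm, hmface, hmmax⟩ := hC.isFace.exists_vertex_max hh hl ⟨j, hj⟩
    have hjl : l (v i) < l (v j) := by simpa [hh] using hCpos j hj hji
    have hCr : coneRank v C = 2 := by rw [hC.rank_eq, hir]
    obtain ⟨H, hH, -⟩ := hC.isFace.exists_cover isConeFace_univ
      ((Set.subset_univ C).ssubset_of_ne fun e => by rw [e, hr] at hCr; omega)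
    obtain ⟨f, rfl⟩ : ∃ f, (ζ f).1 = H :=
      ⟨ζ.symm ⟨H, hH.isFace, by rw [hH.rank_eq, hCr]⟩, by simp⟩
    have hFf := hvertex i hi F f hF (hH.subset (hC.subset rfl))
    have := himax m ⟨hmface, f, hH.subset hm, fun G hG => hFf ▸ hbadF G hG⟩
    exact absurd (hjl.trans_le (hmmax j hj)) (not_lt.2 this)
  have hface : ∀ F, ∃ G, t ∈ (ζ G).1 ∧ z F = z G := fun F => by
    obtain ⟨i, hi, hif, -⟩ := (ζ F).2.1.exists_vertex_max hh hl
      (nonempty_of_coneRank_pos (v := v) (by rw [(ζ F).2.2]; omega))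
    exact hpath i hif F hi
  obtain ⟨F', hF', hFF'⟩ := hface F
  obtain ⟨G', hG', hGG'⟩ := hface G
  rw [hFF', hGG', hvertex t ht F' G' hF' hG']

theorem nonempty_coneFaceOfRank_three (hh : ∀ i, h (v i) = 1) (hr : coneRank v Set.univ = 4) :
    Nonempty (ConeFaceOfRank v 3) := by
  have step : ∀ {A}, IsConeFace v A → coneRank v A < 4 →
      ∃ C, IsConeFace v C ∧ coneRank v C = coneRank v A + 1 := fun {A} hA hlt => by
    obtain ⟨C, hC, -⟩ := hA.exists_cover isConeFace_univ
      ((Set.subset_univ A).ssubset_of_ne fun e => by rw [e, hr] at hlt; omega)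
    exact ⟨C, hC.isFace, hC.rank_eq⟩
  have h0 := coneRank_empty (v := v)
  obtain ⟨A, hA, hAr⟩ := step (isConeFace_empty hh) (by omega)
  obtain ⟨B, hB, hBr⟩ := step hA (by omega)
  obtain ⟨C, hC, hCr⟩ := step hB (by omega)
  exact ⟨C, hC, by omega⟩

omit [Fintype κ] in
theorem finrank_span_coneFaceWord (hh : ∀ i, h (v i) = 1) (hv : Function.Injective v)
    (hr : coneRank v Set.univ = 4) :
    finrank (ZMod 2) (span (ZMod 2) (Set.range (coneFaceWord ε ζ))) + 1 = Fintype.card Z := by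
  have hker : LinearMap.ker (Fintype.linearCombination (ZMod 2) (coneFaceWord ε ζ)) =
      span (ZMod 2) {(1 : Z → ZMod 2)} := by
    obtain ⟨F₀⟩ := ζ.nonempty_congr.2 (nonempty_coneFaceOfRank_three hh hr)
    refine le_antisymm (fun z hz => ?_) ?_
    · rw [LinearMap.mem_ker, Fintype.linearCombination_apply] at hz
      refine mem_span_singleton.2 ⟨z F₀, funext fun F => ?_⟩
      simpa using eq_of_sum_smul_coneFaceWord_eq_zero ε ζ hh hv hr hz F₀ F
    · rw [span_singleton_le_iff_mem, LinearMap.mem_ker, Fintype.linearCombination_apply]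
      simpa using sum_coneFaceWord ε ζ hr
  have hne : (1 : Z → ZMod 2) ≠ 0 := by
    obtain ⟨F₀⟩ := ζ.nonempty_congr.2 (nonempty_coneFaceOfRank_three hh hr)
    exact fun e => one_ne_zero (congrFun e F₀)
  have := LinearMap.finrank_range_add_finrank_ker
    (Fintype.linearCombination (ZMod 2) (coneFaceWord ε ζ))
  rwa [hker, finrank_span_singleton hne, Fintype.range_linearCombination,
    finrank_fintype_fun_eq_card] at this

end ConeCode

/-! ### Homogenization: polyhedra and cones -/

theorem finrank_span_image_prodMk_one {E : Type*} [AddCommGroup E] [Module ℝ E]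
    [FiniteDimensional ℝ E] {T : Set E} (hT : T.Nonempty) :
    finrank ℝ (span ℝ ((fun x => (x, (1 : ℝ))) '' T)) = finrank ℝ (vectorSpan ℝ T) + 1 := by
  obtain ⟨t, ht⟩ := hT
  have hspan : span ℝ ((fun x => (x, (1 : ℝ))) '' T) =
      (vectorSpan ℝ T).map (LinearMap.inl ℝ E ℝ) ⊔ span ℝ {(t, (1 : ℝ))} := by
    apply le_antisymm
    · rw [span_le]
      rintro _ ⟨x, hx, rfl⟩
      refine mem_sup.2 ⟨(x - t, 0), ⟨x - t, vsub_mem_vectorSpan ℝ hx ht, rfl⟩, (t, 1),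
        mem_span_singleton_self _, by simp⟩
    · refine sup_le ?_ (span_mono (Set.singleton_subset_iff.2 ⟨t, ht, rfl⟩))
      rw [vectorSpan_eq_span_vsub_set_right ℝ ht, map_span, span_le]
      rintro _ ⟨_, ⟨x, hx, rfl⟩, rfl⟩
      have : LinearMap.inl ℝ E ℝ (x -ᵥ t) = (x, 1) - (t, 1) := by simp
      simp only [this]
      exact sub_mem (subset_span ⟨x, hx, rfl⟩) (subset_span ⟨t, ht, rfl⟩)
  have hinf : (vectorSpan ℝ T).map (LinearMap.inl ℝ E ℝ) ⊓ span ℝ {(t, (1 : ℝ))} = ⊥ := by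
    rw [eq_bot_iff]
    rintro x ⟨⟨y, -, rfl⟩, hx⟩
    obtain ⟨a, ha⟩ := mem_span_singleton.1 hx
    have h2 : a = 0 := by simpa using congrArg Prod.snd ha
    rw [mem_bot, ← ha, h2, zero_smul]
  have h := Submodule.finrank_sup_add_finrank_inf_eq
    ((vectorSpan ℝ T).map (LinearMap.inl ℝ E ℝ)) (span ℝ {(t, (1 : ℝ))})
  rw [hinf, finrank_bot, add_zero, ← hspan, finrank_span_singleton (by simp),
    ← (equivMapOfInjective _ LinearMap.inl_injective (vectorSpan ℝ T)).finrank_eq] at h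
  exact h

/-- Krein–Milman: extreme points of `F` are extreme in the whole hull, hence lie in `S`. -/
theorem IsExposed.eq_convexHull_inter {E : Type*} [NormedAddCommGroup E] [NormedSpace ℝ E]
    {S F : Set E} (hS : S.Finite) (hF : IsExposed ℝ (convexHull ℝ S) F) :
    F = convexHull ℝ (S ∩ F) := by
  have hc := hS.isCompact_convexHull (𝕜 := ℝ)
  have hFconv := hF.convex (convex_convexHull ℝ S)
  refine subset_antisymm ?_ (convexHull_min Set.inter_subset_right hFconv)
  calc F = closure (convexHull ℝ (F.extremePoints ℝ)) :=
        (closure_convexHull_extremePoints (hF.isCompact hc) hFconv).symm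
    _ ⊆ closure (convexHull ℝ (S ∩ F)) := by
        gcongr
        exact Set.subset_inter ((hF.isExtreme.extremePoints_subset_extremePoints).trans
          extremePoints_convexHull_subset) extremePoints_subset
    _ = convexHull ℝ (S ∩ F) :=
        ((hS.inter_of_left F).isCompact_convexHull (𝕜 := ℝ)).isClosed.closure_eq

/-- The vectors `(s, 1)` for `s ∈ S`, spanning the homogenization of the convex hull of `S`. -/
def homogenization {E : Type*} (S : Set E) : S → E × ℝ := fun s => (s.1, 1)

theorem homogenization_injective {E : Type*} (S : Set E) :
    Function.Injective (homogenization S) :=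
  fun _ _ hab => Subtype.ext (congrArg Prod.fst hab)

theorem coneRank_homogenization {E : Type*} [AddCommGroup E] [Module ℝ E]
    [FiniteDimensional ℝ E] {S : Set E} {A : Set S} (hA : A.Nonempty) :
    coneRank (homogenization S) A =
      finrank ℝ (vectorSpan ℝ (convexHull ℝ (Subtype.val '' A))) + 1 := by
  rw [← direction_affineSpan ℝ (convexHull ℝ _), affineSpan_convexHull, direction_affineSpan,
    ← finrank_span_image_prodMk_one (hA.image _), coneRank, Set.image_image]
  rfl

section Exposed

variable {E : Type*} [NormedAddCommGroup E] [NormedSpace ℝ E] {S F : Set E}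

theorem IsExposed.isConeFace_homogenization (hF : IsExposed ℝ (convexHull ℝ S) F)
    (hne : F.Nonempty) : IsConeFace (homogenization S) (Subtype.val ⁻¹' F) := by
  obtain ⟨l, rfl⟩ := hF hne
  obtain ⟨x, hxP, hx⟩ := hne
  refine ⟨l x • LinearMap.snd ℝ E ℝ - (l : E →ₗ[ℝ] ℝ) ∘ₗ LinearMap.fst ℝ E ℝ,
    fun i => ?_, fun i => ?_⟩
  · simpa [homogenization] using hx i.1 (subset_convexHull ℝ S i.2)
  · simp only [homogenization, Set.mem_preimage, Set.mem_ofPred_eq, LinearMap.sub_apply,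
      LinearMap.smul_apply, LinearMap.snd_apply, smul_eq_mul, mul_one, LinearMap.comp_apply,
      LinearMap.fst_apply, ContinuousLinearMap.coe_coe, sub_eq_zero]
    constructor
    · rintro ⟨hi, hmax⟩
      exact (hmax x hxP).antisymm (hx _ hi)
    · intro h
      exact ⟨subset_convexHull ℝ S i.2, fun y hy => h ▸ hx y hy⟩

theorem IsConeFace.exists_isExposed [FiniteDimensional ℝ E] {A : Set S}
    (hA : IsConeFace (homogenization S) A) (hne : A.Nonempty) :
    ∃ F, IsExposed ℝ (convexHull ℝ S) F ∧ Subtype.val ⁻¹' F = A := by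
  obtain ⟨w, hw, hw0⟩ := hA
  set l : E →L[ℝ] ℝ := LinearMap.toContinuousLinearMap (w ∘ₗ LinearMap.inl ℝ E ℝ) with hl
  obtain ⟨b, hsplit⟩ : ∃ b, ∀ x : E, w (x, 1) = l x + b :=
    ⟨w (0, 1), fun x => by simp [hl, ← map_add]⟩
  have hpos : ∀ x ∈ convexHull ℝ S, 0 ≤ l x + b := by
    have hsub : convexHull ℝ S ⊆ {x | -b ≤ l x} := by
      refine convexHull_min (fun s hs => ?_) (convex_halfSpace_ge l.toLinearMap.isLinear _)
      have := hw ⟨s, hs⟩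
      simp only [homogenization, hsplit] at this
      simp only [Set.mem_ofPred_eq]
      linarith
    intro x hx
    have := hsub hx
    simp only [Set.mem_ofPred_eq] at this
    linarith
  obtain ⟨a, ha⟩ := hne
  have ha0 : l a + b = 0 := by rw [← hsplit]; exact (hw0 a).1 ha
  -- The sign flips because exposed faces consist of maximizers, while `l + b` is minimal, namely 0,
  -- on this one.
  refine ⟨{x ∈ convexHull ℝ S | l x + b = 0}, fun _ => ⟨-l, ?_⟩, ?_⟩
  · ext x
    simp only [Set.mem_ofPred_eq, neg_apply, neg_le_neg_iff]
    refine and_congr_right fun hx => ⟨fun h y hy => ?_, fun h => ?_⟩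
    · linarith [hpos y hy]
    · linarith [hpos x hx, h a (subset_convexHull ℝ S a.2)]
  · ext i
    rw [hw0 i]
    simp only [Set.mem_preimage, Set.mem_ofPred_eq, homogenization, hsplit, and_iff_right_iff_imp]
    exact fun _ => subset_convexHull ℝ S i.2

end Exposed

/-! ### The face correspondence and the conclusion -/

namespace ConvexPolyhedron

variable {Γ : ConvexPolyhedron} {S : Set (EuclideanSpace ℝ (Fin 3))}

theorem IsFaceOfDim.eq_convexHull (hS : S.Finite) (hΓ : Γ.carrier = convexHull ℝ S) {d : ℕ}
    {F : Set (EuclideanSpace ℝ (Fin 3))} (hF : Γ.IsFaceOfDim d F) :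
    F = convexHull ℝ (Subtype.val '' (Subtype.val ⁻¹' F : Set S)) := by
  rw [Subtype.image_preimage_coe]
  exact (hΓ ▸ hF.2.1 : IsExposed ℝ (convexHull ℝ S) F).eq_convexHull_inter hS

/-- The `d`-dimensional faces of a polyhedron correspond to the `(d + 1)`-dimensional faces of
the cone over it. -/
def faceEquiv (hS : S.Finite) (hΓ : Γ.carrier = convexHull ℝ S) (d : ℕ) :
    {F // Γ.IsFaceOfDim d F} ≃ ConeFaceOfRank (homogenization S) (d + 1) where
  toFun F := ⟨Subtype.val ⁻¹' F.1,
    (hΓ ▸ F.2.2.1 : IsExposed ℝ (convexHull ℝ S) F.1).isConeFace_homogenization F.2.1, by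
      have heq := F.2.eq_convexHull hS hΓ
      have hne : (Subtype.val ⁻¹' F.1 : Set S).Nonempty := by
        have := F.2.1
        rw [heq, convexHull_nonempty_iff] at this
        exact Set.image_nonempty.1 this
      rw [coneRank_homogenization hne, ← heq, F.2.2.2]⟩
  invFun A := ⟨convexHull ℝ (Subtype.val '' A.1), by
    have hne : A.1.Nonempty := nonempty_of_coneRank_pos (by rw [A.2.2]; omega)
    obtain ⟨F, hF, hFA⟩ := A.2.1.exists_isExposed hne
    have heq : F = convexHull ℝ (Subtype.val '' A.1) := by
      rw [← hFA, Subtype.image_preimage_coe]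
      exact hF.eq_convexHull_inter hS
    refine ⟨by simpa using hne, hΓ ▸ heq ▸ hF, ?_⟩
    have := coneRank_homogenization hne
    rw [A.2.2] at this
    omega⟩
  left_inv F := Subtype.ext (F.2.eq_convexHull hS hΓ).symm
  right_inv A := by
    have hne : A.1.Nonempty := nonempty_of_coneRank_pos (by rw [A.2.2]; omega)
    obtain ⟨F, hF, hFA⟩ := A.2.1.exists_isExposed hne
    have heq : F = convexHull ℝ (Subtype.val '' A.1) := by
      rw [← hFA, Subtype.image_preimage_coe]
      exact hF.eq_convexHull_inter hS
    refine Subtype.ext ?_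
    simp only
    rw [← heq, hFA]

theorem faceEquiv_subset_iff (hS : S.Finite) (hΓ : Γ.carrier = convexHull ℝ S) {d d' : ℕ}
    (F : {F // Γ.IsFaceOfDim d F}) (G : {F // Γ.IsFaceOfDim d' F}) :
    (faceEquiv hS hΓ d F).1 ⊆ (faceEquiv hS hΓ d' G).1 ↔ F.1 ⊆ G.1 := by
  refine ⟨fun h => ?_, fun h => Set.preimage_mono h⟩
  rw [F.2.eq_convexHull hS hΓ, G.2.eq_convexHull hS hΓ]
  exact convexHull_mono (Set.image_mono h)

theorem coneRank_univ (hΓ : Γ.carrier = convexHull ℝ S) :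
    coneRank (homogenization S) Set.univ = 4 := by
  have hne : S.Nonempty := by
    have := Γ.interior_nonempty.mono interior_subset
    rw [hΓ] at this
    simpa using this
  have htop : affineSpan ℝ (convexHull ℝ S) = ⊤ := by
    have h := Γ.interior_nonempty
    rw [hΓ] at h
    refine top_unique ?_
    rw [← isOpen_interior.affineSpan_eq_top h]
    exact affineSpan_mono ℝ interior_subset
  have : Nonempty S := hne.to_subtype
  rw [coneRank_homogenization Set.univ_nonempty, Set.image_univ, Subtype.range_coe,
    ← direction_affineSpan, htop, AffineSubspace.direction_top, finrank_top]
  simp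

end ConvexPolyhedron

theorem mainTheorem7 (Γ : ConvexPolyhedron) (v e f : ℕ)
    (_hv : Nat.card Γ.Vertex = v) (_he : Nat.card Γ.Edge = e) (hf : Nat.card Γ.Face = f)
    (label : Fin e ≃ Γ.Edge) :
    1 ≤ f ∧ IsBinaryLinearCode e (f - 1) (Γ.code label) ∧
      (Submodule.span (ZMod 2) (Set.range (Γ.faceVector label)) : Set (Fin e → ZMod 2)) =
        Γ.code label := by
  classical
  obtain ⟨S, hS, hΓ⟩ := Γ.exists_finite_hull
  have : Finite S := hS
  have : Fintype Γ.Face := Fintype.ofFinite _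
  let ε : Fin e ≃ ConeFaceOfRank (homogenization S) 2 :=
    label.trans (ConvexPolyhedron.faceEquiv hS hΓ 1)
  let ζ : Γ.Face ≃ ConeFaceOfRank (homogenization S) 3 := ConvexPolyhedron.faceEquiv hS hΓ 2
  have hh : ∀ i, LinearMap.snd ℝ (EuclideanSpace ℝ (Fin 3)) ℝ (homogenization S i) = 1 :=
    fun _ => rfl
  have hinj := homogenization_injective S
  have hr := ConvexPolyhedron.coneRank_univ hΓ
  have hword : Γ.faceVector label = coneFaceWord ε ζ := by
    funext F i
    unfold ConvexPolyhedron.faceVector coneFaceWord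
    exact if_congr (ConvexPolyhedron.faceEquiv_subset_iff hS hΓ (label i) F).symm rfl rfl
  have hcode : (coneCode ε : Set (Fin e → ZMod 2)) = Γ.code label := by
    ext c
    refine (Equiv.forall_congr_left (ConvexPolyhedron.faceEquiv hS hΓ 0).symm).trans
      (forall_congr' fun x => ?_)
    have hfilter : ∀ i, ((ConvexPolyhedron.faceEquiv hS hΓ 0).symm.symm x).1 ⊆ (ε i).1 ↔
        x.1 ⊆ (label i).1 := fun i => ConvexPolyhedron.faceEquiv_subset_iff hS hΓ x (label i)
    simp only [hfilter]
  have hspan := span_coneFaceWord ε ζ hh hinj hr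
  have hrank := finrank_span_coneFaceWord ε ζ hh hinj hr
  rw [← Nat.card_eq_fintype_card, hf] at hrank
  -- `hrank` has the form rank + 1 = `f`, so `f - 1` is not truncated.
  refine ⟨by omega, ⟨coneCode ε, hcode, ?_⟩, ?_⟩
  · rw [← hspan]
    omega
  · rw [hword, hspan, hcode]
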